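/- \textbf{Proposition.} For a continuous function $x:[0,1]\to\mathbb R$ with $x(0)=x(1)=0$, $p\ge 1$, $n\in\mathbb N=\{1,2,\dots\}$, $m\in\mathbb N_0$ and $0\le k\le 2^m-1$, let $$V_n^{(p)}=\sum_{k=0}^{2^n-1}\bigl|x((k+1)2^{-n})-x(k2^{-n})\bigr|^p,\qquad \theta_{m,k}=2^{m/2}\Bigl(2x\Bigl(\tfrac{2k+1}{2^{m+1}}\Bigr)-x\Bigl(\tfrac{k}{2^m}\Bigr)-x\Bigl(\tfrac{k+1}{2^m}\Bigr)\Bigr),\qquad s_n=\Bigl(\sum_{m=0}^{n-1}\sum_{k=0}^{2^m-1}\theta_{m,k}^2\Bigr)^{1/2}.$$ Let $(U_k)_{k\ge1}$ be an i.i.d. sequence of $\{0,1\}$-valued random variables with $\mathbb P(U_k=1)=\tfrac12$ on some probability space, and put $R_m=\sum_{k=1}^m2^{-k}U_k$ (so $R_0=0$) and $S_m=2^m\theta_{m,2^mR_m}^2$. For every $p\ge1$ there are constants $0<A_p\le B_p<\infty$, depending only on $p$ (neither on $x$, nor on $n$, nor on the probability space), such that for all such $x$ and all $n\in\mathbb N$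 $$V_n^{(p)}\le B_p\,2^{n(1-p)}\,\mathbb E\Bigl[\Bigl(\sum_{m=0}^{n-1}S_m\Bigr)^{p/2}\Bigr],$$ and, if $p>1$, also $$A_p\,2^{n(1-p)}\,\mathbb E\Bigl[\Bigl(\sum_{m=0}^{n-1}S_m\Bigr)^{p/2}\Bigr]\le V_n^{(p)}.$$ Moreover, for $p=2$, $V_n^{(2)}=2^{-n}s_n^2$ for all such $x$ and all $n\in\mathbb N$. -/

import Mathlib

open MeasureTheory ProbabilityTheory

noncomputable section

/-- The `p`-th variation of `x` along the `n`-th dyadic partition of `[0,1]`. -/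
def dyadicVariation (x : ℝ → ℝ) (p : ℝ) (n : ℕ) : ℝ :=
  ∑ k ∈ Finset.range (2 ^ n),
    |x (((k : ℝ) + 1) / 2 ^ n) - x ((k : ℝ) / 2 ^ n)| ^ p

/-- The Faber-Schauder coefficient `θ_{m,k}` of `x`. -/
def faberSchauderCoeff (x : ℝ → ℝ) (m k : ℕ) : ℝ :=
  (2 : ℝ) ^ ((m : ℝ) / 2) *
    (2 * x ((2 * (k : ℝ) + 1) / 2 ^ (m + 1)) - x ((k : ℝ) / 2 ^ m) - x (((k : ℝ) + 1) / 2 ^ m))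

/-- The quantity `s_n`, the Euclidean norm of the coefficients of the generations `m < n`. -/
def gladyshevNorm (x : ℝ → ℝ) (n : ℕ) : ℝ :=
  Real.sqrt (∑ m ∈ Finset.range n, ∑ k ∈ Finset.range (2 ^ m), faberSchauderCoeff x m k ^ 2)

/-- An i.i.d. sequence of symmetric Bernoulli variables with values in `{0, 1}`. The sequence is
indexed from `0`: the `j`-th term of the Lean sequence is `U_{j+1}`. -/
structure IsFairBitSequence {Ω : Type*} [MeasurableSpace Ω] (P : Measure Ω)
    (U : ℕ → Ω → Fin 2) : Prop where
  measurable : ∀ j, Measurable (U j)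
  indep : iIndepFun U P
  prob_one : ∀ j, P {ω | U j ω = 1} = 1 / 2

/-- The random dyadic point `R_m = ∑_{k=1}^m 2^{-k} U_k`. -/
def dyadicPoint {Ω : Type*} (U : ℕ → Ω → Fin 2) (m : ℕ) (ω : Ω) : ℝ :=
  ∑ j ∈ Finset.range m, ((U j ω : ℕ) : ℝ) / 2 ^ (j + 1)

/-- `S_m = 2^m θ_{m, 2^m R_m}^2`. The floor only converts the number `2^m R_m`, which is a
nonnegative integer (see `natFloor_dyadicPoint`), into an element of `ℕ`. -/
def squareTerm {Ω : Type*} (x : ℝ → ℝ) (U : ℕ → Ω → Fin 2) (m : ℕ) (ω : Ω) : ℝ :=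
  2 ^ m * faberSchauderCoeff x m ⌊2 ^ m * dyadicPoint U m ω⌋₊ ^ 2

theorem natFloor_dyadicPoint {Ω : Type*} (U : ℕ → Ω → Fin 2) (m : ℕ) (ω : Ω) :
    ((⌊2 ^ m * dyadicPoint U m ω⌋₊ : ℕ) : ℝ) = 2 ^ m * dyadicPoint U m ω := by
  have h : ∃ k : ℕ, 2 ^ m * dyadicPoint U m ω = (k : ℝ) := by
    refine ⟨∑ j ∈ Finset.range m, (U j ω : ℕ) * 2 ^ (m - (j + 1)), ?_⟩
    unfold dyadicPoint
    push_cast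
    rw [Finset.mul_sum]
    refine Finset.sum_congr rfl fun j hj => ?_
    have hj' : j + 1 ≤ m := Finset.mem_range.mp hj
    have h2 : (2 : ℝ) ^ m = 2 ^ (m - (j + 1)) * 2 ^ (j + 1) := by
      rw [← pow_add, Nat.sub_add_cancel hj']
    rw [h2]
    field_simp
  obtain ⟨k, hk⟩ := h
  rw [hk, Nat.floor_natCast]

end

/-! ### Power inequalities -/

/-! Choose a dyadic interval of generation n uniformly at random. The slopes of `x` on its ancestors
and on itself form a martingale M started at x(1) - x(0) = 0: passing to a half adds d or -d, where
d is known beforehand and d² = S_m. Thus V_n is 2^{n(1-p)} E|M_n|^p, the sum of the S_m is the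
bracket of M, and the claim is the Burkholder-Davis-Gundy inequality for M at a fixed time.

With q = p/2, it is proved by explicit functions f(a, s) of martingale and bracket whose mean cannot
increase (`IsDyadicSupersolution`). If f(0, 0) = 0, the mean of f stays nonpositive, and a pointwise
bound ½ g - C h ≤ f yields E g ≤ 2C E h (`IsDyadicSupersolution.sum_rpow_le`). Each of the two
bounds needs one f for q ≤ 1, resting on concavity of powers, and one for q ≥ 1, resting on tangent
lines and a Young inequality. The lower bound for q ≤ 1 also uses `two_point_increment_le`, whose
constant (2q - 1)² vanishes at p = 1. For p = 2 the parallelogram law suffices. -/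

theorem rpow_add_rpow_le_two_mul_midpoint {q a b c : ℝ} (hq0 : 0 ≤ q) (hq1 : q ≤ 1)
    (ha : 0 ≤ a) (hb : 0 ≤ b) (hc : a + b = 2 * c) : a ^ q + b ^ q ≤ 2 * c ^ q := by
  have h := (Real.concaveOn_rpow hq0 hq1).2 (Set.mem_Ici.2 ha) (Set.mem_Ici.2 hb)
    (by norm_num : (0 : ℝ) ≤ 1 / 2) (by norm_num : (0 : ℝ) ≤ 1 / 2) (by norm_num)
  simp only [smul_eq_mul] at h
  rw [show 1 / 2 * a + 1 / 2 * b = c by linarith] at h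
  linarith

/-- Increments of a concave function over a fixed length decrease to the right: a and s + h are
convex combinations of s and a + h with swapped weights. -/
theorem rpow_add_le_rpow_add_of_le {q a s h : ℝ} (hq0 : 0 ≤ q) (hq1 : q ≤ 1)
    (hs : 0 ≤ s) (hsa : s ≤ a) (hh : 0 ≤ h) :
    (a + h) ^ q + s ^ q ≤ a ^ q + (s + h) ^ q := by
  rcases hh.eq_or_lt with rfl | hpos
  · simp
  have hw : 0 < a + h - s := by linarith
  have hconc := Real.concaveOn_rpow hq0 hq1
  have hmem : s ∈ Set.Ici (0 : ℝ) := hs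
  have hmem' : a + h ∈ Set.Ici (0 : ℝ) := Set.mem_Ici.2 (by linarith)
  have h1 : 0 ≤ h / (a + h - s) := by positivity
  have h2 : 0 ≤ (a - s) / (a + h - s) := div_nonneg (by linarith) hw.le
  have h3 : h / (a + h - s) + (a - s) / (a + h - s) = 1 := by field_simp; ring
  have e1 := hconc.2 hmem hmem' h1 h2 h3
  have e2 := hconc.2 hmem hmem' h2 h1 (by rw [add_comm]; exact h3)
  simp only [smul_eq_mul] at e1 e2
  rw [show h / (a + h - s) * s + (a - s) / (a + h - s) * (a + h) = a by
    field_simp; ring] at e1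
  rw [show (a - s) / (a + h - s) * s + h / (a + h - s) * (a + h) = s + h by
    field_simp; ring] at e2
  have h4 : (a - s) / (a + h - s) = 1 - h / (a + h - s) := by linarith
  rw [h4] at e1 e2
  nlinarith

/-- The tangent line inequality for a convex power. -/
theorem rpow_sub_rpow_le_mul_sub {q s t : ℝ} (hq : 1 ≤ q) (hs : 0 ≤ s) (ht : 0 ≤ t) :
    t ^ q - s ^ q ≤ q * t ^ (q - 1) * (t - s) := by
  rcases ht.eq_or_lt with rfl | hpos
  · rcases hq.eq_or_lt with rfl | hq'
    · simp
    · rw [Real.zero_rpow (by linarith : q - 1 ≠ 0), Real.zero_rpow (by linarith : q ≠ 0)]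
      have := Real.rpow_nonneg hs q
      linarith
  have hb := one_add_mul_self_le_rpow_one_add (s := s / t - 1)
    (by have : 0 ≤ s / t := by positivity
        linarith) hq
  rw [show 1 + (s / t - 1) = s / t by ring, Real.div_rpow hs ht] at hb
  have htq : t ^ q = t ^ (q - 1) * t := by
    rw [← Real.rpow_add_one hpos.ne']; ring_nf
  have hp : 0 < t ^ (q - 1) := Real.rpow_pos_of_pos hpos _
  rw [le_div_iff₀ (by positivity), htq] at hb
  have : (1 + q * (s / t - 1)) * (t ^ (q - 1) * t) = t ^ (q - 1) * t + q * t ^ (q - 1) * (s - t) := by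
    field_simp
  rw [htq]
  linarith

/-- A Young inequality, by comparing b with 2Ka. The coefficient 1/2 lets the b-term be absorbed. -/
theorem mul_rpow_sub_one_le {q K a b : ℝ} (hq : 1 ≤ q) (hK : 0 < K) (ha : 0 ≤ a) (hb : 0 ≤ b) :
    K * a * b ^ (q - 1) ≤ 1 / 2 * b ^ q + K * (2 * K) ^ (q - 1) * a ^ q := by
  have key : ∀ c : ℝ, 0 ≤ c → c * c ^ (q - 1) = c ^ q := fun c hc => by
    rcases hc.eq_or_lt with rfl | hc
    · rw [Real.zero_rpow (by linarith : q ≠ 0), zero_mul]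
    · rw [mul_comm, ← Real.rpow_add_one hc.ne']; ring_nf
  have hbq := Real.rpow_nonneg hb q
  have haq := Real.rpow_nonneg ha q
  have hb1 := Real.rpow_nonneg hb (q - 1)
  have hK1 : 0 < (2 * K) ^ (q - 1) := by positivity
  rcases le_total (2 * K * a) b with h | h
  · have : K * a * b ^ (q - 1) ≤ 1 / 2 * b ^ q := by
      rw [← key b hb]; nlinarith
    have : 0 ≤ K * (2 * K) ^ (q - 1) * a ^ q := by positivity
    linarith
  · have h1 : b ^ (q - 1) ≤ (2 * K * a) ^ (q - 1) := Real.rpow_le_rpow hb h (by linarith)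
    rw [Real.mul_rpow (by positivity) ha] at h1
    have h2 := mul_le_mul_of_nonneg_left h1 (by positivity : 0 ≤ K * a)
    have h3 : K * a * ((2 * K) ^ (q - 1) * a ^ (q - 1)) = K * (2 * K) ^ (q - 1) * a ^ q := by
      rw [← key a ha]; ring
    linarith

/-- The factor u keeps this valid when q - 1 < 1: since v ≤ u, the left side is at most u^q - v^q,
and the tangent line at u applies. -/
theorem rpow_sub_rpow_mul_le {q u v : ℝ} (hq : 1 ≤ q) (hv : 0 ≤ v) (hvu : v ≤ u) :
    (u ^ (q - 1) - v ^ (q - 1)) * u ≤ q * u ^ (q - 1) * (u - v) := by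
  rcases (hv.trans hvu).eq_or_lt with rfl | hu
  · have : v = 0 := le_antisymm hvu hv
    subst this; simp
  have hvq := Real.rpow_nonneg hv (q - 1)
  have huq : 0 < u ^ (q - 1) := Real.rpow_pos_of_pos hu _
  have key : ∀ c : ℝ, 0 ≤ c → c ^ (q - 1) * c = c ^ q := fun c hc => by
    rcases hc.eq_or_lt with rfl | hc
    · rw [Real.zero_rpow (by linarith : q ≠ 0), mul_zero]
    · rw [← Real.rpow_add_one hc.ne']; ring_nf
  have h := rpow_sub_rpow_le_mul_sub hq hv hu.le
  rw [← key u hu.le, ← key v hv] at h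
  nlinarith

/-- Bernoulli bounds u^(2-p) above by a linear function, hence u^p = u² / u^(2-p) below by a
rational one; clearing denominators leaves a nonnegative t⁴ term. -/
theorem two_add_le_rpow_add_rpow {p t : ℝ} (hp1 : 1 < p) (hp2 : p ≤ 2) (ht0 : 0 ≤ t)
    (ht1 : t ≤ 1) : 2 + 2 * (p - 1) ^ 2 * t ^ 2 ≤ (1 + t) ^ p + (1 - t) ^ p := by
  have key : ∀ u : ℝ, 0 ≤ u → u ^ 2 / (1 + (2 - p) * (u - 1)) ≤ u ^ p := by
    intro u hu
    rcases hu.eq_or_lt with rfl | hu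
    · simp [Real.zero_rpow (by linarith : p ≠ 0)]
    have hu' : 0 < u⁻¹ := inv_pos.2 hu
    have hden : 0 < 1 + (2 - p) * (u - 1) := by nlinarith
    have hb := rpow_one_add_le_one_add_mul_self (s := u - 1) (by linarith)
      (by linarith : 0 ≤ 2 - p) (by linarith)
    rw [show 1 + (u - 1) = u by ring] at hb
    rw [div_le_iff₀ hden]
    have h2 : u ^ 2 = u ^ p * u ^ (2 - p) := by
      rw [← Real.rpow_add hu, ← Real.rpow_natCast]; norm_num
    rw [h2]
    exact mul_le_mul_of_nonneg_left hb (Real.rpow_nonneg hu.le _)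
  have h1 := key (1 + t) (by linarith)
  have h2 := key (1 - t) (by linarith)
  have d1 : 0 < 1 + (2 - p) * (1 + t - 1) := by nlinarith
  have d2 : 0 < 1 + (2 - p) * (1 - t - 1) := by nlinarith
  refine le_trans ?_ (add_le_add h1 h2)
  rw [div_add_div _ _ d1.ne' d2.ne', le_div_iff₀ (mul_pos d1 d2)]
  have : (1 + t) ^ 2 * (1 + (2 - p) * (1 - t - 1)) + (1 + (2 - p) * (1 + t - 1)) * (1 - t) ^ 2
      - (2 + 2 * (p - 1) ^ 2 * t ^ 2) * ((1 + (2 - p) * (1 + t - 1)) * (1 + (2 - p) * (1 - t - 1)))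
      = 2 * (p - 1) ^ 2 * (2 - p) ^ 2 * t ^ 4 := by ring
  have : 0 ≤ 2 * (p - 1) ^ 2 * (2 - p) ^ 2 * t ^ 4 := by positivity
  linarith

/-! ### Supermartingale functions of a dyadic martingale and its bracket -/

/-- If a dyadic martingale at `a` with bracket `s` moves to `a ± d`, then the mean of `f` at the
two new positions is at most its value at the old one. -/
def IsDyadicSupersolution (f : ℝ → ℝ → ℝ) : Prop :=
  ∀ a s d : ℝ, 0 ≤ s → f (a + d) (s + d ^ 2) + f (a - d) (s + d ^ 2) ≤ 2 * f a s

/-- Concavity enters three times: at the midpoint a² + s + 2d², in moving the increment of length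
2d² down to s, and in halving that length. The halving costs the factor 2. -/
theorem isDyadicSupersolution_upper_of_le_one {q : ℝ} (hq0 : 0 ≤ q) (hq1 : q ≤ 1) :
    IsDyadicSupersolution fun a s => (a ^ 2 + s) ^ q - 2 * s ^ q := by
  intro a s d hs
  have h1 : ((a + d) ^ 2 + (s + d ^ 2)) ^ q + ((a - d) ^ 2 + (s + d ^ 2)) ^ q
      ≤ 2 * (a ^ 2 + s + 2 * d ^ 2) ^ q :=
    rpow_add_rpow_le_two_mul_midpoint hq0 hq1 (by positivity) (by positivity) (by ring)
  have h2 := rpow_add_le_rpow_add_of_le hq0 hq1 hs (by nlinarith : s ≤ a ^ 2 + s)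
    (by positivity : 0 ≤ 2 * d ^ 2)
  have h3 : s ^ q + (s + 2 * d ^ 2) ^ q ≤ 2 * (s + d ^ 2) ^ q :=
    rpow_add_rpow_le_two_mul_midpoint hq0 hq1 hs (by positivity) (by ring)
  simp only
  linarith

/-- The mean of a² grows by d², so the subtracted term gains at least q d² (s + d²)^(q-1), which by
the tangent line pays for the growth of s^q. -/
theorem isDyadicSupersolution_lower_of_one_le {q : ℝ} (hq : 1 ≤ q) :
    IsDyadicSupersolution fun a s => s ^ q - q * a ^ 2 * s ^ (q - 1) := by
  intro a s d hs
  have ht : 0 ≤ s + d ^ 2 := by positivity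
  have h1 := rpow_sub_rpow_le_mul_sub hq hs ht
  have h2 : s ^ (q - 1) ≤ (s + d ^ 2) ^ (q - 1) :=
    Real.rpow_le_rpow hs (by nlinarith) (by linarith)
  have h3 := mul_le_mul_of_nonneg_left h2 (by positivity : 0 ≤ q * a ^ 2)
  simp only
  nlinarith

theorem isDyadicSupersolution_upper_of_one_le {q : ℝ} (hq : 1 ≤ q) :
    IsDyadicSupersolution fun a s =>
      (a ^ 2 + s) ^ q - (2 * q + 8 * q ^ 2) * s * (a ^ 2 + s) ^ (q - 1) := by
  have key : ∀ a s d : ℝ, 0 ≤ s → 0 ≤ a * d →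
      ((a + d) ^ 2 + (s + d ^ 2)) ^ q
        - (2 * q + 8 * q ^ 2) * (s + d ^ 2) * ((a + d) ^ 2 + (s + d ^ 2)) ^ (q - 1)
        + (((a - d) ^ 2 + (s + d ^ 2)) ^ q
        - (2 * q + 8 * q ^ 2) * (s + d ^ 2) * ((a - d) ^ 2 + (s + d ^ 2)) ^ (q - 1))
        ≤ 2 * ((a ^ 2 + s) ^ q - (2 * q + 8 * q ^ 2) * s * (a ^ 2 + s) ^ (q - 1)) := by
    intro a s d hs had
    obtain ⟨r, hr⟩ : ∃ r, r = a ^ 2 + s := ⟨_, rfl⟩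
    obtain ⟨u, hu⟩ : ∃ u, u = (a + d) ^ 2 + (s + d ^ 2) := ⟨_, rfl⟩
    obtain ⟨v, hv⟩ : ∃ v, v = (a - d) ^ 2 + (s + d ^ 2) := ⟨_, rfl⟩
    have hr0 : 0 ≤ r := by rw [hr]; positivity
    have hu0 : 0 ≤ u := by rw [hu]; positivity
    have hv0 : 0 ≤ v := by rw [hv]; positivity
    have hvu : v ≤ u := by rw [hu, hv]; nlinarith
    have hau : a ^ 2 ≤ u := by rw [hu]; nlinarith [sq_nonneg d]
    rw [← hr, ← hu, ← hv]
    have tu := rpow_sub_rpow_le_mul_sub hq hr0 hu0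
    have tv := rpow_sub_rpow_le_mul_sub hq hr0 hv0
    have tuv := rpow_sub_rpow_mul_le hq hv0 hvu
    -- Since uv ≥ r², the arithmetic-geometric mean inequality gives U + V ≥ 2R even where the power
    -- q - 1 is concave.
    have hmul : (r ^ (q - 1)) ^ 2 ≤ u ^ (q - 1) * v ^ (q - 1) := by
      rw [← Real.mul_rpow hu0 hv0, sq, ← Real.mul_rpow hr0 hr0]
      refine Real.rpow_le_rpow (mul_nonneg hr0 hr0) ?_ (by linarith)
      have : u * v - r * r = 4 * d ^ 2 * s + 4 * d ^ 4 := by rw [hu, hv, hr]; ring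
      have : 0 ≤ 4 * d ^ 2 * s + 4 * d ^ 4 := by positivity
      linarith
    have hU := Real.rpow_nonneg hu0 (q - 1)
    have hV := Real.rpow_nonneg hv0 (q - 1)
    have hR := Real.rpow_nonneg hr0 (q - 1)
    have e1 : u - r = 2 * d ^ 2 + 2 * (a * d) := by rw [hu, hr]; ring
    have e2 : v - r = 2 * d ^ 2 - 2 * (a * d) := by rw [hv, hr]; ring
    have e3 : u - v = 4 * (a * d) := by rw [hu, hv]; ring
    rw [e1] at tu
    rw [e2] at tv
    rw [e3] at tuv
    clear hr hv
    generalize u ^ (q - 1) = U at *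
    generalize v ^ (q - 1) = V at *
    generalize r ^ (q - 1) = R at *
    have hsum : 2 * R ≤ U + V := by nlinarith [sq_nonneg (U - V)]
    -- The first-order terms cancel only up to 2q · ad(U - V); this bound on it produces the 8q² in
    -- the constant.
    have hcross : (a * d) * (U - V) ≤ 4 * q * d ^ 2 * U := by
      rcases hu0.eq_or_lt with h0 | hpos
      · have : d ^ 2 = 0 := le_antisymm
          (by nlinarith [sq_nonneg (a + d), sq_nonneg d]) (sq_nonneg d)
        have hd : d = 0 := by simpa using this
        simp [hd]
      · refine le_of_mul_le_mul_right ?_ hpos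
        have h1 := mul_le_mul_of_nonneg_left tuv had
        have h2 := mul_le_mul_of_nonneg_left hau (by positivity : 0 ≤ 4 * q * d ^ 2 * U)
        nlinarith
    have hC : 0 ≤ (2 * q + 8 * q ^ 2) * s := by positivity
    have h4 := mul_le_mul_of_nonneg_left hsum hC
    have h5 := mul_le_mul_of_nonneg_left hcross (by linarith : 0 ≤ 2 * q)
    have h6 : 0 ≤ 8 * q ^ 2 * d ^ 2 * V := by positivity
    linarith
  intro a s d hs
  rcases le_total 0 (a * d) with h | h
  · exact key a s d hs h
  · have := key a s (-d) hs (by linarith)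
    simp only [neg_sq, ← sub_eq_add_neg, sub_neg_eq_add] at this
    simp only
    linarith

/-- By symmetry and homogeneity only the ratio t ≤ 1 of the smaller to the larger of |a|, |d|
matters; both regimes reduce to the two-point inequality with exponent 2q. -/
theorem two_point_increment_le {q : ℝ} (hq0 : 1 / 2 < q) (hq1 : q ≤ 1) (a d : ℝ) :
    (2 * q - 1) ^ 2 * ((a ^ 2 + 2 * d ^ 2) ^ q - (a ^ 2) ^ q)
      ≤ ((a + d) ^ 2) ^ q + ((a - d) ^ 2) ^ q - 2 * (a ^ 2) ^ q := by
  have hpow : ∀ u : ℝ, 0 ≤ u → (u ^ 2) ^ q = u ^ (2 * q) := fun u hu => by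
    rw [← Real.rpow_natCast u 2, ← Real.rpow_mul hu]; norm_num
  have hc : 0 ≤ (2 * q - 1) ^ 2 := sq_nonneg _
  have hcq : (2 * q - 1) ^ 2 ≤ q := by nlinarith
  have small : ∀ a d : ℝ, 0 < a → 0 ≤ d → d ≤ a →
      (2 * q - 1) ^ 2 * ((a ^ 2 + 2 * d ^ 2) ^ q - (a ^ 2) ^ q)
      ≤ ((a + d) ^ 2) ^ q + ((a - d) ^ 2) ^ q - 2 * (a ^ 2) ^ q := by
    intro a d ha hd hda
    obtain ⟨t, rfl⟩ : ∃ t, d = a * t := ⟨d / a, by field_simp⟩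
    have ht0 : 0 ≤ t := by by_contra! h; nlinarith
    have ht1 : t ≤ 1 := by by_contra! h; nlinarith
    have h := two_add_le_rpow_add_rpow (p := 2 * q) (by linarith) (by linarith) ht0 ht1
    have hb := rpow_one_add_le_one_add_mul_self (s := 2 * t ^ 2)
      (by nlinarith) (by linarith : 0 ≤ q) hq1
    rw [show a ^ 2 + 2 * (a * t) ^ 2 = a ^ 2 * (1 + 2 * t ^ 2) by ring,
      show (a + a * t) ^ 2 = a ^ 2 * (1 + t) ^ 2 by ring,
      show (a - a * t) ^ 2 = a ^ 2 * (1 - t) ^ 2 by ring,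
      Real.mul_rpow (by positivity) (by positivity), Real.mul_rpow (by positivity) (by positivity),
      Real.mul_rpow (by positivity) (by positivity), hpow (1 + t) (by linarith),
      hpow (1 - t) (by linarith)]
    have hA : 0 ≤ (a ^ 2) ^ q := by positivity
    have h1 : (1 + 2 * t ^ 2) ^ q - 1 ≤ 2 * t ^ 2 := by nlinarith [sq_nonneg t]
    have h2 := mul_le_mul_of_nonneg_left h1 hc
    have h3 : (2 * q - 1) ^ 2 * ((1 + 2 * t ^ 2) ^ q - 1)
      ≤ (1 + t) ^ (2 * q) + (1 - t) ^ (2 * q) - 2 := by linarith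
    have h4 := mul_le_mul_of_nonneg_left h3 hA
    linarith
  have large : ∀ a d : ℝ, 0 ≤ a → 0 < d → a ≤ d →
      (2 * q - 1) ^ 2 * ((a ^ 2 + 2 * d ^ 2) ^ q - (a ^ 2) ^ q)
      ≤ ((a + d) ^ 2) ^ q + ((a - d) ^ 2) ^ q - 2 * (a ^ 2) ^ q := by
    intro a d ha hd hda
    obtain ⟨t, rfl⟩ : ∃ t, a = d * t := ⟨a / d, by field_simp⟩
    have ht0 : 0 ≤ t := by by_contra! h; nlinarith
    have ht1 : t ≤ 1 := by by_contra! h; nlinarith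
    have h := two_add_le_rpow_add_rpow (p := 2 * q) (by linarith) (by linarith) ht0 ht1
    have hb := rpow_one_add_le_one_add_mul_self (s := t ^ 2 - 1)
      (by nlinarith) (by linarith : 0 ≤ q) hq1
    rw [show 1 + (t ^ 2 - 1) = t ^ 2 by ring] at hb
    have hsub := rpow_add_le_rpow_add_of_le (by linarith : 0 ≤ q) hq1 le_rfl
      (sq_nonneg t) (by norm_num : (0 : ℝ) ≤ 2)
    rw [zero_add, Real.zero_rpow (by linarith : q ≠ 0)] at hsub
    have h2q : (2 : ℝ) ^ q ≤ 2 := by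
      simpa using Real.rpow_le_rpow_of_exponent_le (by norm_num : (1 : ℝ) ≤ 2) hq1
    rw [show (d * t) ^ 2 + 2 * d ^ 2 = d ^ 2 * (t ^ 2 + 2) by ring,
      show (d * t + d) ^ 2 = d ^ 2 * (1 + t) ^ 2 by ring,
      show (d * t - d) ^ 2 = d ^ 2 * (1 - t) ^ 2 by ring, mul_pow,
      Real.mul_rpow (by positivity) (by positivity), Real.mul_rpow (by positivity) (by positivity),
      Real.mul_rpow (by positivity) (by positivity), Real.mul_rpow (by positivity) (by positivity),
      hpow (1 + t) (by linarith), hpow (1 - t) (by linarith)]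
    have hA : 0 ≤ (d ^ 2) ^ q := by positivity
    have h1 : (t ^ 2 + 2) ^ q - (t ^ 2) ^ q ≤ 2 := by linarith
    have h2 := mul_le_mul_of_nonneg_left h1 hc
    have ht2 : t ^ 2 ≤ 1 := by nlinarith
    -- As t² ≤ 1, Bernoulli's slope q may be lowered to (2q - 1)²; the t² terms then cancel.
    have h5 : (t ^ 2) ^ q ≤ 1 + (2 * q - 1) ^ 2 * (t ^ 2 - 1) := by nlinarith
    have h3 : (2 * q - 1) ^ 2 * ((t ^ 2 + 2) ^ q - (t ^ 2) ^ q)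
      ≤ (1 + t) ^ (2 * q) + (1 - t) ^ (2 * q) - 2 * (t ^ 2) ^ q := by linarith
    have h4 := mul_le_mul_of_nonneg_left h3 hA
    linarith
  have nonneg : ∀ a d : ℝ, 0 ≤ a → 0 ≤ d →
      (2 * q - 1) ^ 2 * ((a ^ 2 + 2 * d ^ 2) ^ q - (a ^ 2) ^ q)
      ≤ ((a + d) ^ 2) ^ q + ((a - d) ^ 2) ^ q - 2 * (a ^ 2) ^ q := by
    intro a d ha hd
    rcases hd.eq_or_lt with rfl | hd'
    · simp; linarith
    rcases le_total a d with h | h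
    · exact large a d ha hd' h
    · exact small a d (hd'.trans_le h) hd h
  have h := nonneg |a| |d| (abs_nonneg a) (abs_nonneg d)
  rw [sq_abs, sq_abs] at h
  rcases le_total 0 a with ha | ha <;> rcases le_total 0 d with hd | hd <;>
    simp only [abs_of_nonneg, abs_of_nonpos, ha, hd] at h
  · exact h
  · rw [sub_neg_eq_add, ← sub_eq_add_neg] at h; linarith
  · rw [show (-a + d) ^ 2 = (a - d) ^ 2 by ring, show (-a - d) ^ 2 = (a + d) ^ 2 by ring] at h
    linarith
  · rw [show (-a + -d) ^ 2 = (a + d) ^ 2 by ring, show (-a - -d) ^ 2 = (a - d) ^ 2 by ring] at h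
    linarith

/-- By concavity the growth of the first term is largest at s = 0, where the two-point estimate
compares it with the growth of |a|^(2q). -/
theorem isDyadicSupersolution_lower_of_le_one {q : ℝ} (hq0 : 1 / 2 < q) (hq1 : q ≤ 1) :
    IsDyadicSupersolution fun a s => (a ^ 2 + s) ^ q - 2 / (2 * q - 1) ^ 2 * (a ^ 2) ^ q := by
  intro a s d hs
  have hc : 0 < (2 * q - 1) ^ 2 := by have : 0 < 2 * q - 1 := by linarith
                                      positivity
  have h1 : ((a + d) ^ 2 + (s + d ^ 2)) ^ q + ((a - d) ^ 2 + (s + d ^ 2)) ^ q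
      ≤ 2 * (a ^ 2 + s + 2 * d ^ 2) ^ q :=
    rpow_add_rpow_le_two_mul_midpoint (by linarith) hq1 (by positivity) (by positivity) (by ring)
  have h2 := rpow_add_le_rpow_add_of_le (by linarith) hq1 (sq_nonneg a)
    (by linarith : a ^ 2 ≤ a ^ 2 + s) (by positivity : 0 ≤ 2 * d ^ 2)
  have h3 := two_point_increment_le hq0 hq1 a d
  have h4 := mul_le_mul_of_nonneg_left h3 (by positivity : 0 ≤ 2 / (2 * q - 1) ^ 2)
  rw [← mul_assoc, div_mul_cancel₀ _ hc.ne'] at h4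
  simp only
  linarith

/-! ### The dyadic martingale of a function -/

theorem sum_range_two_pow_succ {M : Type*} [AddCommMonoid M] (f : ℕ → M) (n : ℕ) :
    ∑ k ∈ Finset.range (2 ^ (n + 1)), f k
      = ∑ k ∈ Finset.range (2 ^ n), (f (2 * k) + f (2 * k + 1)) := by
  rw [pow_succ']
  induction 2 ^ n with
  | zero => simp
  | succ N ih =>
    rw [Finset.sum_range_succ, ← ih, mul_add, mul_one, Finset.sum_range_succ,
      Finset.sum_range_succ, add_assoc]

/-- The slope of `x` on the `k`-th dyadic interval of generation `n`. -/
noncomputable def dyadicSlope (x : ℝ → ℝ) (n k : ℕ) : ℝ :=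
  2 ^ n * (x (((k : ℝ) + 1) / 2 ^ n) - x ((k : ℝ) / 2 ^ n))

/-- The half difference of the slopes of `x` on the two halves of a dyadic interval. -/
noncomputable def dyadicJump (x : ℝ → ℝ) (n k : ℕ) : ℝ :=
  2 ^ n * (2 * x ((2 * (k : ℝ) + 1) / 2 ^ (n + 1)) - x ((k : ℝ) / 2 ^ n)
    - x (((k : ℝ) + 1) / 2 ^ n))

/-- The sum of the squared jumps over the proper dyadic ancestors of an interval. -/
noncomputable def dyadicBracket (x : ℝ → ℝ) : ℕ → ℕ → ℝ
  | 0, _ => 0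
  | n + 1, k => dyadicBracket x n (k / 2) + dyadicJump x n (k / 2) ^ 2

theorem dyadicBracket_nonneg (x : ℝ → ℝ) (n k : ℕ) : 0 ≤ dyadicBracket x n k := by
  induction n generalizing k with
  | zero => exact le_rfl
  | succ n ih => exact add_nonneg (ih _) (sq_nonneg _)

theorem dyadicSlope_left (x : ℝ → ℝ) (n k : ℕ) :
    dyadicSlope x (n + 1) (2 * k) = dyadicSlope x n k + dyadicJump x n k := by
  unfold dyadicSlope dyadicJump
  have h : ((2 * k : ℕ) : ℝ) / 2 ^ (n + 1) = k / 2 ^ n := by push_cast; field_simp; ring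
  rw [h]
  push_cast
  ring

theorem dyadicSlope_right (x : ℝ → ℝ) (n k : ℕ) :
    dyadicSlope x (n + 1) (2 * k + 1) = dyadicSlope x n k - dyadicJump x n k := by
  unfold dyadicSlope dyadicJump
  have h : (((2 * k + 1 : ℕ) : ℝ) + 1) / 2 ^ (n + 1) = ((k : ℝ) + 1) / 2 ^ n := by
    push_cast; field_simp; ring
  rw [h]
  push_cast
  ring

theorem dyadicJump_sq (x : ℝ → ℝ) (n k : ℕ) :
    dyadicJump x n k ^ 2 = 2 ^ n * faberSchauderCoeff x n k ^ 2 := by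
  unfold dyadicJump faberSchauderCoeff
  have h : ((2 : ℝ) ^ ((n : ℝ) / 2)) ^ 2 = 2 ^ n := by
    rw [← Real.rpow_natCast, ← Real.rpow_mul (by norm_num), ← Real.rpow_natCast]
    norm_num
  rw [mul_pow, mul_pow, h]
  ring

theorem IsDyadicSupersolution.sum_le {f : ℝ → ℝ → ℝ} (hf : IsDyadicSupersolution f)
    (x : ℝ → ℝ) (n : ℕ) :
    ∑ k ∈ Finset.range (2 ^ n), f (dyadicSlope x n k) (dyadicBracket x n k)
      ≤ 2 ^ n * f (x 1 - x 0) 0 := by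
  induction n with
  | zero => simp [dyadicSlope, dyadicBracket]
  | succ n ih =>
    rw [sum_range_two_pow_succ, pow_succ', mul_assoc]
    refine le_trans ?_ (mul_le_mul_of_nonneg_left ih (by norm_num : (0 : ℝ) ≤ 2))
    rw [Finset.mul_sum]
    refine Finset.sum_le_sum fun k _ => ?_
    rw [dyadicSlope_left, dyadicSlope_right]
    simp only [dyadicBracket]
    rw [show 2 * k / 2 = k by omega, show (2 * k + 1) / 2 = k by omega]
    exact hf _ _ _ (dyadicBracket_nonneg x n k)

theorem IsDyadicSupersolution.sum_rpow_le {f g h : ℝ → ℝ → ℝ} (hf : IsDyadicSupersolution f)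
    (hf0 : f 0 0 = 0) {C : ℝ} (hgh : ∀ a s, 0 ≤ s → 1 / 2 * g a s - C * h a s ≤ f a s)
    {x : ℝ → ℝ} (hx : x 1 = x 0) (n : ℕ) :
    ∑ k ∈ Finset.range (2 ^ n), g (dyadicSlope x n k) (dyadicBracket x n k)
      ≤ 2 * C * ∑ k ∈ Finset.range (2 ^ n), h (dyadicSlope x n k) (dyadicBracket x n k) := by
  have h1 := hf.sum_le x n
  rw [hx, sub_self, hf0, mul_zero] at h1
  have h2 := (Finset.sum_le_sum fun k (_ : k ∈ Finset.range (2 ^ n)) =>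
    hgh (dyadicSlope x n k) _ (dyadicBracket_nonneg x n k)).trans h1
  rw [Finset.sum_sub_distrib, ← Finset.mul_sum, ← Finset.mul_sum] at h2
  linarith

theorem exists_sum_slope_le_sum_bracket {q : ℝ} (hq : 0 < q) :
    ∃ C : ℝ, 0 < C ∧ ∀ x : ℝ → ℝ, x 1 = x 0 → ∀ n : ℕ,
      ∑ k ∈ Finset.range (2 ^ n), (dyadicSlope x n k ^ 2) ^ q
        ≤ C * ∑ k ∈ Finset.range (2 ^ n), dyadicBracket x n k ^ q := by
  have mono : ∀ a s : ℝ, 0 ≤ s → (a ^ 2) ^ q ≤ (a ^ 2 + s) ^ q := fun a s hs =>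
    Real.rpow_le_rpow (sq_nonneg a) (by linarith) hq.le
  rcases le_total q 1 with hq1 | hq1
  -- One factor 2 is the coefficient in the supersolution, the other undoes the 1/2 before g.
  · refine ⟨2 * 2, by norm_num, fun x hx n => ?_⟩
    refine (isDyadicSupersolution_upper_of_le_one hq.le hq1).sum_rpow_le
      (g := fun a _ => (a ^ 2) ^ q) (h := fun _ s => s ^ q) ?_ ?_ hx n
    · simp [Real.zero_rpow hq.ne']
    · intro a s hs
      have := mono a s hs
      have : 0 ≤ (a ^ 2) ^ q := by positivity
      linarith
  · have hK : 0 < 2 * q + 8 * q ^ 2 := by positivity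
    refine ⟨2 * ((2 * q + 8 * q ^ 2) * (2 * (2 * q + 8 * q ^ 2)) ^ (q - 1)), by positivity,
      fun x hx n => ?_⟩
    refine (isDyadicSupersolution_upper_of_one_le hq1).sum_rpow_le
      (g := fun a _ => (a ^ 2) ^ q) (h := fun _ s => s ^ q) ?_ ?_ hx n
    · simp [Real.zero_rpow hq.ne']
    · intro a s hs
      have h1 := mono a s hs
      have h2 := mul_rpow_sub_one_le hq1 hK hs (by positivity : 0 ≤ a ^ 2 + s)
      linarith

theorem exists_sum_bracket_le_sum_slope {q : ℝ} (hq : 1 / 2 < q) :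
    ∃ C : ℝ, 0 < C ∧ ∀ x : ℝ → ℝ, x 1 = x 0 → ∀ n : ℕ,
      ∑ k ∈ Finset.range (2 ^ n), dyadicBracket x n k ^ q
        ≤ C * ∑ k ∈ Finset.range (2 ^ n), (dyadicSlope x n k ^ 2) ^ q := by
  have hq0 : q ≠ 0 := by linarith
  rcases le_total q 1 with hq1 | hq1
  · have hc : 0 < 2 * q - 1 := by linarith
    refine ⟨2 * (2 / (2 * q - 1) ^ 2), by positivity, fun x hx n => ?_⟩
    refine (isDyadicSupersolution_lower_of_le_one hq hq1).sum_rpow_le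
      (g := fun _ s => s ^ q) (h := fun a _ => (a ^ 2) ^ q) ?_ ?_ hx n
    · simp [Real.zero_rpow hq0]
    · intro a s hs
      have : s ^ q ≤ (a ^ 2 + s) ^ q := Real.rpow_le_rpow hs (by nlinarith) (by linarith)
      have : 0 ≤ s ^ q := by positivity
      linarith
  · have hK : 0 < q := by linarith
    refine ⟨2 * (q * (2 * q) ^ (q - 1)), by positivity, fun x hx n => ?_⟩
    refine (isDyadicSupersolution_lower_of_one_le hq1).sum_rpow_le
      (g := fun _ s => s ^ q) (h := fun a _ => (a ^ 2) ^ q) ?_ ?_ hx n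
    · simp [Real.zero_rpow hq0]
    · intro a s hs
      have h2 := mul_rpow_sub_one_le hq1 hK (sq_nonneg a) hs
      linarith

theorem dyadicVariation_eq (x : ℝ → ℝ) (p : ℝ) (n : ℕ) :
    dyadicVariation x p n = (2 : ℝ) ^ (-((n : ℝ) * p)) *
      ∑ k ∈ Finset.range (2 ^ n), (dyadicSlope x n k ^ 2) ^ (p / 2) := by
  unfold dyadicVariation dyadicSlope
  rw [Finset.mul_sum]
  refine Finset.sum_congr rfl fun k _ => ?_
  have h2 : ∀ y : ℝ, (y ^ 2) ^ (p / 2) = |y| ^ p := fun y => by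
    rw [← sq_abs, ← Real.rpow_natCast, ← Real.rpow_mul (abs_nonneg y)]
    congr 1; push_cast; ring
  rw [h2, abs_mul, Real.mul_rpow (abs_nonneg _) (abs_nonneg _),
    abs_of_pos (by positivity : (0 : ℝ) < 2 ^ n), ← Real.rpow_natCast 2 n, ← Real.rpow_mul (by norm_num), ← mul_assoc,
    ← Real.rpow_add (by norm_num)]
  simp

theorem gladyshevNorm_sq (x : ℝ → ℝ) (n : ℕ) :
    gladyshevNorm x n ^ 2 =
      ∑ m ∈ Finset.range n, ∑ k ∈ Finset.range (2 ^ m), faberSchauderCoeff x m k ^ 2 :=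
  Real.sq_sqrt (Finset.sum_nonneg fun _ _ => Finset.sum_nonneg fun _ _ => sq_nonneg _)

/-- Squaring slope ± jump and adding cancels the cross terms, so each generation contributes its
squared jumps. -/
theorem dyadicVariation_two {x : ℝ → ℝ} (hx : x 1 = x 0) (n : ℕ) :
    dyadicVariation x 2 n = gladyshevNorm x n ^ 2 / 2 ^ n := by
  have key : ∑ k ∈ Finset.range (2 ^ n), dyadicSlope x n k ^ 2
      = 2 ^ n * ∑ m ∈ Finset.range n, ∑ k ∈ Finset.range (2 ^ m),
        faberSchauderCoeff x m k ^ 2 := by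
    induction n with
    | zero => simp [dyadicSlope, hx]
    | succ n ih =>
      have h : ∀ k, dyadicSlope x (n + 1) (2 * k) ^ 2 + dyadicSlope x (n + 1) (2 * k + 1) ^ 2
          = 2 * dyadicSlope x n k ^ 2 + 2 ^ (n + 1) * faberSchauderCoeff x n k ^ 2 := fun k => by
        rw [dyadicSlope_left, dyadicSlope_right, pow_succ' 2, mul_assoc, ← dyadicJump_sq]; ring
      rw [sum_range_two_pow_succ, Finset.sum_congr rfl fun k _ => h k, Finset.sum_add_distrib,
        ← Finset.mul_sum, ← Finset.mul_sum, ih, Finset.sum_range_succ]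
      ring
  have hpow : (2 : ℝ) ^ (-((n : ℝ) * 2)) = (2 ^ n * 2 ^ n)⁻¹ := by
    rw [Real.rpow_neg (by norm_num), ← pow_add, ← Real.rpow_natCast]
    congr 2; push_cast; ring
  rw [dyadicVariation_eq, gladyshevNorm_sq, hpow]
  simp only [div_self (two_ne_zero' ℝ), Real.rpow_one]
  rw [key]
  field_simp

/-! ### The random dyadic interval -/

/-- The natural number with the first `n` binary digits of `u`, the most significant one first. -/
def bitIndex (u : ℕ → Fin 2) : ℕ → ℕ
  | 0 => 0
  | n + 1 => 2 * bitIndex u n + (u n : ℕ)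

theorem bitIndex_congr {u v : ℕ → Fin 2} {n : ℕ} (h : ∀ j < n, u j = v j) :
    bitIndex u n = bitIndex v n := by
  induction n with
  | zero => rfl
  | succ n ih =>
    simp only [bitIndex]
    rw [ih fun j hj => h j (by omega), h n (by omega)]

theorem two_pow_mul_dyadicPoint {Ω : Type*} (U : ℕ → Ω → Fin 2) (n : ℕ) (ω : Ω) :
    2 ^ n * dyadicPoint U n ω = bitIndex (fun j => U j ω) n := by
  induction n with
  | zero => simp [dyadicPoint, bitIndex]
  | succ n ih =>
    simp only [bitIndex]
    push_cast
    rw [← ih]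
    unfold dyadicPoint
    rw [Finset.sum_range_succ]
    field_simp
    ring

theorem natFloor_eq_bitIndex {Ω : Type*} (U : ℕ → Ω → Fin 2) (n : ℕ) (ω : Ω) :
    ⌊2 ^ n * dyadicPoint U n ω⌋₊ = bitIndex (fun j => U j ω) n := by
  rw [two_pow_mul_dyadicPoint, Nat.floor_natCast]

/-- Dropping the last binary digit passes to the parent interval, so the S_m are the squared jumps
along the ancestors. -/
theorem sum_squareTerm {Ω : Type*} (x : ℝ → ℝ) (U : ℕ → Ω → Fin 2) (n : ℕ) (ω : Ω) :
    ∑ m ∈ Finset.range n, squareTerm x U m ω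
      = dyadicBracket x n (bitIndex (fun j => U j ω) n) := by
  induction n with
  | zero => simp [dyadicBracket]
  | succ n ih =>
    rw [Finset.sum_range_succ, ih]
    simp only [squareTerm, dyadicBracket, bitIndex, natFloor_eq_bitIndex]
    rw [show (2 * bitIndex (fun j => U j ω) n + (U n ω : ℕ)) / 2 = bitIndex (fun j => U j ω) n by
      have := (U n ω).isLt; omega, dyadicJump_sq]

theorem IsFairBitSequence.integral_comp_bit {Ω : Type*} [MeasurableSpace Ω] {P : Measure Ω}
    [IsProbabilityMeasure P] {U : ℕ → Ω → Fin 2} (hU : IsFairBitSequence P U) (n : ℕ)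
    (g : Fin 2 → ℝ) : ∫ ω, g (U n ω) ∂P = (g 0 + g 1) / 2 := by
  have hm := hU.measurable n
  have h1 : P.real (U n ⁻¹' {1}) = 1 / 2 := by
    have := hU.prob_one n
    rw [measureReal_def, show U n ⁻¹' {1} = {ω | U n ω = 1} from rfl, this]
    simp
  have h0 : P.real (U n ⁻¹' {0}) = 1 / 2 := by
    have hc : U n ⁻¹' {0} = (U n ⁻¹' {1})ᶜ := by
      ext ω
      simp only [Set.mem_preimage, Set.mem_singleton_iff, Set.mem_compl_iff]
      omega
    rw [hc, probReal_compl_eq_one_sub (hm (measurableSet_singleton 1)), h1]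
    norm_num
  rw [← integral_map hm.aemeasurable (measurable_of_finite g).aestronglyMeasurable,
    integral_fintype (Integrable.of_finite), Fin.sum_univ_two,
    map_measureReal_apply hm (measurableSet_singleton 0),
    map_measureReal_apply hm (measurableSet_singleton 1), h0, h1]
  simp only [smul_eq_mul]
  ring

/-- The index is uniform on the 2^n intervals: each new digit is fair and independent of the index
built so far. -/
theorem IsFairBitSequence.integral_comp_bitIndex {Ω : Type*} [MeasurableSpace Ω] {P : Measure Ω}
    [IsProbabilityMeasure P] {U : ℕ → Ω → Fin 2} (hU : IsFairBitSequence P U) (n : ℕ)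
    (F : ℕ → ℝ) :
    ∫ ω, F (bitIndex (fun j => U j ω) n) ∂P = (∑ k ∈ Finset.range (2 ^ n), F k) / 2 ^ n := by
  induction n generalizing F with
  | zero => simp [bitIndex]
  | succ n ih =>
    let X : Ω → (Finset.range n → Fin 2) := fun ω i => U i ω
    let Y : Ω → (({n} : Finset ℕ) → Fin 2) := fun ω i => U i ω
    have hX : Measurable X := measurable_pi_lambda _ fun i => hU.measurable i
    have hY : Measurable Y := measurable_pi_lambda _ fun i => hU.measurable i
    have hXY : IndepFun X Y P :=
      hU.indep.indepFun_finset (Finset.range n) {n} (by simp) hU.measurable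
    -- The index factors through the first n digits; the default 0 is never read.
    let G : (Finset.range n → Fin 2) → ℕ := fun v =>
      bitIndex (fun j => if h : j ∈ Finset.range n then v ⟨j, h⟩ else 0) n
    have hG : ∀ ω, bitIndex (fun j => U j ω) n = G (X ω) := fun ω =>
      bitIndex_congr fun j hj => by simp [X, hj]
    have hind : IndepFun (fun ω => bitIndex (fun j => U j ω) n) (U n) P := by
      have h := hXY.comp (φ := G) (ψ := fun v => v ⟨n, Finset.mem_singleton_self n⟩)
        (measurable_of_finite _) (measurable_of_finite _)
      rwa [show G ∘ X = fun ω => bitIndex (fun j => U j ω) n from funext fun ω => (hG ω).symm] at h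
    have hK : Measurable fun ω => bitIndex (fun j => U j ω) n := by
      simp_rw [hG]
      exact (measurable_of_finite G).comp hX
    have hprod : ∀ (f : ℕ → ℝ) (g : Fin 2 → ℝ),
        ∫ ω, f (bitIndex (fun j => U j ω) n) * g (U n ω) ∂P
          = (∑ k ∈ Finset.range (2 ^ n), f k) / 2 ^ n * ((g 0 + g 1) / 2) := fun f g => by
      rw [hind.integral_fun_comp_mul_comp hK.aemeasurable (hU.measurable n).aemeasurable
        (measurable_from_nat).aestronglyMeasurable (measurable_of_finite g).aestronglyMeasurable,
        ih, hU.integral_comp_bit]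
    have hint : ∀ (f : ℕ → ℝ) (g : Fin 2 → ℝ),
        Integrable (fun ω => f (bitIndex (fun j => U j ω) n) * g (U n ω)) P := fun f g => by
      simp_rw [hG]
      exact (Integrable.of_finite (μ := P.map fun ω => (X ω, U n ω))
        (f := fun z => f (G z.1) * g z.2)).comp_measurable (hX.prodMk (hU.measurable n))
    have hsplit : ∀ ω, F (bitIndex (fun j => U j ω) (n + 1))
        = F (2 * bitIndex (fun j => U j ω) n) * (if U n ω = 0 then 1 else 0)
          + F (2 * bitIndex (fun j => U j ω) n + 1) * (if U n ω = 1 then 1 else 0) := fun ω => by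
      simp only [bitIndex]
      generalize U n ω = b
      fin_cases b <;> simp
    simp_rw [hsplit]
    rw [integral_add (hint (fun k => F (2 * k)) fun b => if b = 0 then 1 else 0)
      (hint (fun k => F (2 * k + 1)) fun b => if b = 1 then 1 else 0),
      hprod (fun k => F (2 * k)) fun b => if b = 0 then 1 else 0,
      hprod (fun k => F (2 * k + 1)) fun b => if b = 1 then 1 else 0,
      sum_range_two_pow_succ, Finset.sum_add_distrib]
    simp only [if_true, zero_ne_one, one_ne_zero, if_false]
    field_simp
    ring

theorem IsFairBitSequence.two_rpow_mul_integral {Ω : Type*} [MeasurableSpace Ω] {P : Measure Ω}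
    [IsProbabilityMeasure P] {U : ℕ → Ω → Fin 2} (hU : IsFairBitSequence P U)
    (x : ℝ → ℝ) (p : ℝ) (n : ℕ) :
    (2 : ℝ) ^ ((n : ℝ) * (1 - p)) *
        ∫ ω, (∑ m ∈ Finset.range n, squareTerm x U m ω) ^ (p / 2) ∂P
      = (2 : ℝ) ^ (-((n : ℝ) * p)) *
        ∑ k ∈ Finset.range (2 ^ n), dyadicBracket x n k ^ (p / 2) := by
  simp_rw [sum_squareTerm]
  rw [hU.integral_comp_bitIndex n fun k => dyadicBracket x n k ^ (p / 2),
    show (n : ℝ) * (1 - p) = -(n * p) + n by ring, Real.rpow_add (by norm_num),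
    Real.rpow_natCast]
  field_simp

theorem mainTheorem2 :
    (∀ p : ℝ, 1 ≤ p → ∃ A B : ℝ, 0 < A ∧ A ≤ B ∧
      ∀ (Ω : Type*) [MeasurableSpace Ω] (P : Measure Ω) [IsProbabilityMeasure P]
        (U : ℕ → Ω → Fin 2), IsFairBitSequence P U →
      ∀ x : ℝ → ℝ, ContinuousOn x (Set.Icc 0 1) → x 0 = 0 → x 1 = 0 →
      ∀ n : ℕ, 1 ≤ n →
        (1 < p →
          A * (2 : ℝ) ^ ((n : ℝ) * (1 - p)) *
            ∫ ω, (∑ m ∈ Finset.range n, squareTerm x U m ω) ^ (p / 2) ∂P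
          ≤ dyadicVariation x p n) ∧
        dyadicVariation x p n
          ≤ B * (2 : ℝ) ^ ((n : ℝ) * (1 - p)) *
            ∫ ω, (∑ m ∈ Finset.range n, squareTerm x U m ω) ^ (p / 2) ∂P) ∧
    (∀ x : ℝ → ℝ, ContinuousOn x (Set.Icc 0 1) → x 0 = 0 → x 1 = 0 →
      ∀ n : ℕ, 1 ≤ n → dyadicVariation x 2 n = gladyshevNorm x n ^ 2 / 2 ^ n) := by
  refine ⟨fun p hp => ?_, fun x _ h0 h1 n _ => dyadicVariation_two (h1.trans h0.symm) n⟩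
  obtain ⟨B, hB, hupper⟩ := exists_sum_slope_le_sum_bracket (by linarith : 0 < p / 2)
  obtain ⟨C, hC, hlower⟩ : ∃ C : ℝ, 0 < C ∧ (1 < p → ∀ x : ℝ → ℝ, x 1 = x 0 → ∀ n : ℕ,
      ∑ k ∈ Finset.range (2 ^ n), dyadicBracket x n k ^ (p / 2)
        ≤ C * ∑ k ∈ Finset.range (2 ^ n), (dyadicSlope x n k ^ 2) ^ (p / 2)) := by
    rcases hp.eq_or_lt with rfl | hp'
    · exact ⟨1, one_pos, fun h => absurd h (lt_irrefl _)⟩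
    · obtain ⟨C, hC, h⟩ := exists_sum_bracket_le_sum_slope (by linarith : 1 / 2 < p / 2)
      exact ⟨C, hC, fun _ => h⟩
  -- The minimum only secures A ≤ B; the lower bound itself holds with C⁻¹.
  refine ⟨min B C⁻¹, B, lt_min hB (inv_pos.2 hC), min_le_left _ _, ?_⟩
  intro Ω _ P _ U hU x _ h0 h1 n _
  have hx : x 1 = x 0 := h1.trans h0.symm
  have hpow : (0 : ℝ) ≤ (2 : ℝ) ^ (-((n : ℝ) * p)) := by positivity
  have hQ : 0 ≤ ∑ k ∈ Finset.range (2 ^ n), dyadicBracket x n k ^ (p / 2) :=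
    Finset.sum_nonneg fun k _ => Real.rpow_nonneg (dyadicBracket_nonneg x n k) _
  simp only [mul_assoc]
  rw [hU.two_rpow_mul_integral, dyadicVariation_eq]
  refine ⟨fun hp' => ?_, ?_⟩
  · rw [mul_left_comm]
    refine mul_le_mul_of_nonneg_left ?_ hpow
    refine (mul_le_mul_of_nonneg_right (min_le_right _ _) hQ).trans ?_
    rw [inv_mul_le_iff₀ hC]
    exact hlower hp' x hx n
  · rw [mul_left_comm]
    exact mul_le_mul_of_nonneg_left (hupper x hx n) hpow
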